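/- For each integer $m\ge 1$ let $\mathcal S_m:[0,1]\to\mathbb R$ be a continuous function (the spectral density of a stationary time series), with autocovariance sequence $$r_m(k)=\int_0^1 \mathcal S_m(\nu)\,e^{2\pi i\nu k}\,d\nu,\qquad k\in\mathbb Z.$$ Assume that the spectral densities are uniformly bounded above and away from zero, $$\sup_{m\ge1}\max_{\nu\in[0,1]}\mathcal S_m(\nu)<\infty,\qquad \inf_{m\ge1}\min_{\nu\in[0,1]}\mathcal S_m(\nu)>0,$$ and that for some $\gamma_0>0$ $$\sup_{m\ge1}\ \sum_{k\in\mathbb Z}(1+|k|)^{\gamma_0}\,|r_m(k)|<\infty.$$ For $L\ge1$ let $\mathcal R_{m,L}$ be the $L\times L$ Toeplitz matrix with entries $(\mathcal R_{m,L})_{k,k'}=r_m(k-k')$, let $\mathbf a_L(\nu)=L^{-1/2}\bigl(1,e^{2\pi i\nu},\dots,e^{2\pi i(L-1)\nu}\bigr)^T$, and let $$\epsilon_{m,L}(\nu)=\mathcal S_m(\nu)\,\mathbf a_L(\nu)^H\mathcal R_{m,L}^{-1}\,\mathbf a_L(\nu)-1 .$$ Then all matrices $\mathcal R_{m,L}$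 are invertible (so that $\epsilon_{m,L}$ is well defined), and for each real $\gamma<\gamma_0$ there is a constant $\kappa>0$, independent of $m$, $\nu$ and $L$ (but possibly depending on $\gamma$), such that: - if $\gamma\neq1$, then $\displaystyle \sup_{m\ge1}\sup_{\nu\in[0,1]}|\epsilon_{m,L}(\nu)|\le\frac{\kappa}{L^{\min(\gamma,1)}}$ for all $L\ge1$; - if $\gamma=1$, then $\displaystyle \sup_{m\ge1}\sup_{\nu\in[0,1]}|\epsilon_{m,L}(\nu)|\le\kappa\,\frac{\log L}{L}$ for all $L\ge2$. -/

import Mathlib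

open scoped Matrix

/-- The autocovariance sequence `r(k) = ∫₀¹ S(ν) e^{2πiνk} dν` (`k ∈ ℤ`) associated with the
spectral density `S` on `[0, 1]`. -/
noncomputable def autocovariance (S : ℝ → ℝ) (k : ℤ) : ℂ :=
  ∫ ν in (0 : ℝ)..1, (S ν : ℂ) * Complex.exp (2 * Real.pi * Complex.I * ν * k)

/-- The weighted norm `‖a‖_ω = ∑_{n ∈ ℤ} (1 + |n|)^γ |a(n)|` with values in `[0, ∞]`; a two-sided
sequence `a` lies in the Beurling space `ℓ_ω`, `ω(n) = (1 + |n|)^γ`, iff this is finite. -/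
noncomputable def beurlingNorm (γ : ℝ) (a : ℤ → ℂ) : ENNReal :=
  ∑' n : ℤ, ENNReal.ofReal ((1 + |(n : ℝ)|) ^ γ * ‖a n‖)

/-- The `L × L` Toeplitz covariance matrix with entries `r(k - k')`. -/
noncomputable def covarianceMatrix (S : ℝ → ℝ) (L : ℕ) : Matrix (Fin L) (Fin L) ℂ :=
  Matrix.of fun k k' => autocovariance S (((k : ℕ) : ℤ) - ((k' : ℕ) : ℤ))

/-- The normalized vector
`a_L(ν) = L^{-1/2} (1, e^{2πiν}, …, e^{2πi(L-1)ν})ᵀ`. -/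
noncomputable def steeringVector (L : ℕ) (ν : ℝ) : Fin L → ℂ :=
  fun k => (1 / (Real.sqrt L : ℂ)) * Complex.exp (2 * Real.pi * Complex.I * ((k : ℕ) : ℂ) * ν)

/-- The error `ε_L(ν) = S(ν) a_L(ν)ᴴ R_L⁻¹ a_L(ν) - 1`, where `R_L` is the covariance matrix
associated with `S`. -/
noncomputable def spectralError (S : ℝ → ℝ) (L : ℕ) (ν : ℝ) : ℂ :=
  (S ν : ℂ) *
    (star (steeringVector L ν) ⬝ᵥ ((covarianceMatrix S L)⁻¹ *ᵥ steeringVector L ν)) - 1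

/-!
The proof compares the Toeplitz matrix `R` with the two-sided convolution by the autocovariances,
for which the complex exponential of frequency `ν` is an exact eigenvector with eigenvalue `S(ν)`
(Fourier inversion, `hasSum_autocovariance`). Hence the steering vector `a` satisfies `R a = S(ν) a`
up to a defect `x = S(ν) a - R a`, whose entry `j` is at most `L^{-1/2} t_j`, where `t_j` is the sum
of `|r(k)|` over the lags `k` for which `j - k` leaves the window `[0, L)`
(`truncationMass`, `norm_smul_steeringVector_sub_le`).

Substituting `R a = S(ν) a - x` twice, and using `R = Rᴴ` and `aᴴ a = 1`, gives the second-order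
identity `S(ν) ε = aᴴ x + xᴴ R⁻¹ x`. Since `R` is bounded below by `s = inf S`
(`mul_sum_sq_le_norm_covarianceMatrix`, from `vᴴ R v = ∫ S |∑ vₖ e^{-2πixk}|²` and Parseval), the
last term is at most `s⁻¹ ‖x‖²`. As the `t_j` are bounded by `∑ |r(k)|`, both terms are
controlled by the mean `L⁻¹ ∑ t_j` alone (`norm_spectralError_le`). The operator norm of
`R⁻¹` is thus all that is used of it; no decay of its entries is needed.

Finally a lag `k` leaves the window from `min(|k|, L) ≤ L^{1-α} |k|^α` indices `j`, so that
`L⁻¹ ∑ t_j ≤ L^{-α} ∑ (1 + |k|)^γ₀ |r(k)|` with `α = min(γ₀, 1)` (`sum_truncationMass_le`). This is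
the rate `L^{-min(γ₀, 1)}`, and the bounds for the smaller exponents `γ`, the one with the
logarithm included, follow from it.
-/

/-! ### Fourier inversion for the spectral density -/

open MeasureTheory intervalIntegral in
/-- A continuous `S` on `[0, 1]` with absolutely summable autocovariances is the sum of its Fourier
series on all of `[0, 1]`, endpoints included: no periodicity `S 0 = S 1` is assumed, it follows.
The series converges uniformly, its sum has the same class in `L²` of the circle as `S`, and two
continuous functions that agree almost everywhere on `[0, 1]` agree there. -/
theorem hasSum_autocovariance {S : ℝ → ℝ} (hS : ContinuousOn S (Set.Icc 0 1))
    (hr : Summable fun k => ‖autocovariance S k‖) {ν : ℝ} (hν : ν ∈ Set.Icc (0 : ℝ) 1) :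
    HasSum (fun k : ℤ => autocovariance S k *
      Complex.exp (2 * Real.pi * Complex.I * ν * ((-k : ℤ) : ℂ))) (S ν) := by
  have : Fact ((0 : ℝ) < 1) := ⟨one_pos⟩
  set f : ℝ → ℂ := fun x => (S x : ℂ) with hf
  have hfc : ContinuousOn f (Set.Icc 0 1) := Complex.continuous_ofReal.comp_continuousOn hS
  have hcoeff : ∀ k : ℤ, fourierCoeff (AddCircle.liftIoc (1 : ℝ) 0 f) (-k) =
      autocovariance S k := by
    intro k
    rw [fourierCoeff_liftIoc_eq, fourierCoeffOn_eq_integral, autocovariance]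
    simp only [zero_add, sub_zero, neg_neg, ne_eq, one_ne_zero, not_false_eq_true, div_self,
      one_smul]
    refine intervalIntegral.integral_congr fun x _ => ?_
    simp only [fourier_coe_apply, smul_eq_mul, hf]
    rw [mul_comm]
    congr 2
    rw [zero_add, sub_zero, Complex.ofReal_one]
    ring
  have hmem : MemLp f 2 (volume.restrict (Set.Ioc (0 : ℝ) (0 + 1))) := by
    obtain ⟨C, hC⟩ := isCompact_Icc.exists_bound_of_continuousOn hfc
    rw [zero_add]
    refine MemLp.of_bound ((hfc.mono Set.Ioc_subset_Icc_self).aestronglyMeasurable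
      measurableSet_Ioc) C ?_
    filter_upwards [ae_restrict_mem measurableSet_Ioc] with x hx
    exact hC x (Set.Ioc_subset_Icc_self hx)
  have h := hmem.memLp_liftIoc.haarAddCircle
  have hL2 := hasSum_fourier_series_L2 h.toLp
  simp only [fourierCoeff_congr_ae h.coeFn_toLp] at hL2
  have hcs : Summable fun k : ℤ => ‖fourierCoeff (AddCircle.liftIoc (1 : ℝ) 0 f) k‖ := by
    rw [← (Equiv.neg ℤ).summable_iff]
    simpa [Function.comp_def, hcoeff] using hr
  have hcs' : Summable fun k : ℤ =>
      fourierCoeff (AddCircle.liftIoc (1 : ℝ) 0 f) k • fourier (T := (1 : ℝ)) k := by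
    refine .of_norm ?_
    simpa only [norm_smul, fourier_norm, mul_one] using hcs
  obtain ⟨G, hG⟩ := hcs'
  have hGL := (ContinuousMap.toLp (E := ℂ) 2 (AddCircle.haarAddCircle (T := (1 : ℝ)))
    ℂ).hasSum hG
  have hGf : ContinuousMap.toLp (E := ℂ) 2 AddCircle.haarAddCircle ℂ G = h.toLp := by
    refine hGL.unique ?_
    simpa [Function.comp_def] using hL2
  have hae : (G : AddCircle (1 : ℝ) → ℂ) =ᵐ[AddCircle.haarAddCircle]
      AddCircle.liftIoc (1 : ℝ) 0 f := by
    refine (ContinuousMap.coeFn_toLp (p := 2) (𝕜 := ℂ) AddCircle.haarAddCircle G).symm.trans ?_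
    rw [hGf]
    exact h.coeFn_toLp
  have hae' : (fun x : ℝ => G (x : AddCircle (1 : ℝ))) =ᵐ[volume.restrict (Set.Icc 0 1)] f := by
    have hvol : (G : AddCircle (1 : ℝ) → ℂ) =ᵐ[volume] AddCircle.liftIoc (1 : ℝ) 0 f := by
      rw [AddCircle.volume_eq_smul_haarAddCircle]
      exact Measure.ae_smul_measure hae _
    have h1 := (AddCircle.measurePreserving_mk (1 : ℝ) 0).quasiMeasurePreserving.ae_eq_comp hvol
    rw [zero_add, ← Measure.restrict_congr_set Ioc_ae_eq_Icc.symm] at h1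
    have hIoc : ∀ᵐ x ∂(volume.restrict (Set.Icc (0 : ℝ) 1)), x ∈ Set.Ioc (0 : ℝ) 1 := by
      rw [Measure.restrict_congr_set Ioc_ae_eq_Icc.symm]
      exact ae_restrict_mem measurableSet_Ioc
    filter_upwards [h1, hIoc] with x hx hx'
    simp only [Function.comp_apply] at hx
    rw [hx, AddCircle.liftIoc_coe_apply (by simpa using hx')]
  have hEq := Measure.eqOn_Icc_of_ae_eq volume zero_ne_one hae'
    (G.continuous.comp (AddCircle.continuous_mk' 1)).continuousOn hfc hν
  have hev := (ContinuousMap.evalCLM ℂ (ν : AddCircle (1 : ℝ))).hasSum hG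
  rw [← (Equiv.neg ℤ).hasSum_iff] at hev
  have hval : (ContinuousMap.evalCLM ℂ (ν : AddCircle (1 : ℝ))) G = (S ν : ℂ) := hEq
  rw [hval] at hev
  convert! hev using 1
  funext k
  simp only [Function.comp_apply, Equiv.neg_apply, map_smul, hcoeff, smul_eq_mul,
    ContinuousMap.evalCLM_apply, fourier_coe_apply, Complex.ofReal_one, div_one]
  congr 2
  ring

/-! ### The Hermitian form of the covariance matrix -/

/-- The Hermitian form of the covariance matrix is integration against the spectral density:
`vᴴ R v = ∫₀¹ S(x) |∑ₖ vₖ e^{-2πixk}|² dx`. -/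
theorem star_dotProduct_covarianceMatrix_mulVec {S : ℝ → ℝ} (hS : ContinuousOn S (Set.Icc 0 1))
    {L : ℕ} (v : Fin L → ℂ) :
    star v ⬝ᵥ (covarianceMatrix S L *ᵥ v) =
      ((∫ x in (0 : ℝ)..1, S x * ‖∑ k : Fin L,
        v k * Complex.exp (-(2 * Real.pi * Complex.I * x * (k : ℕ)))‖ ^ 2 : ℝ) : ℂ) := by
  have hSc : ContinuousOn (fun x => (S x : ℂ)) (Set.uIcc 0 1) := by
    rw [Set.uIcc_of_le zero_le_one]
    exact Complex.continuous_ofReal.comp_continuousOn hS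
  rw [← intervalIntegral.integral_ofReal]
  have hexp : ∀ x : ℝ, ((S x * ‖∑ k : Fin L,
      v k * Complex.exp (-(2 * Real.pi * Complex.I * x * (k : ℕ)))‖ ^ 2 : ℝ) : ℂ) =
      ∑ k : Fin L, ∑ l : Fin L, star (v k) * v l * ((S x : ℂ) *
        Complex.exp (2 * Real.pi * Complex.I * x * ((((k : ℕ) : ℤ) - ((l : ℕ) : ℤ) : ℤ) : ℂ))) := by
    intro x
    rw [Complex.ofReal_mul, Complex.ofReal_pow, ← Complex.conj_mul', map_sum,
      Finset.sum_mul_sum, Finset.mul_sum]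
    refine Finset.sum_congr rfl fun k _ => ?_
    rw [Finset.mul_sum]
    refine Finset.sum_congr rfl fun l _ => ?_
    have : (2 * Real.pi * Complex.I * x * ((((k : ℕ) : ℤ) - ((l : ℕ) : ℤ) : ℤ) : ℂ)) =
        (starRingEnd ℂ) (-(2 * Real.pi * Complex.I * x * (k : ℕ))) +
          -(2 * Real.pi * Complex.I * x * (l : ℕ)) := by
      simp [Complex.conj_ofNat]
      ring
    rw [this, Complex.exp_add, map_mul, ← Complex.exp_conj, starRingEnd_apply, starRingEnd_apply]
    ring
  have hint : ∀ (c : ℂ) (n : ℤ), IntervalIntegrable (fun x : ℝ => c * ((S x : ℂ) *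
      Complex.exp (2 * Real.pi * Complex.I * x * (n : ℂ)))) MeasureTheory.volume 0 1 := by
    intro c n
    refine ContinuousOn.intervalIntegrable (continuousOn_const.mul (hSc.mul ?_))
    exact Continuous.continuousOn (by fun_prop)
  simp_rw [hexp]
  rw [intervalIntegral.integral_finsetSum]
  · simp only [dotProduct, Matrix.mulVec, Finset.mul_sum, Pi.star_apply]
    refine Finset.sum_congr rfl fun k _ => ?_
    rw [intervalIntegral.integral_finsetSum fun l _ => hint _ _]
    refine Finset.sum_congr rfl fun l _ => ?_
    rw [intervalIntegral.integral_const_mul, covarianceMatrix, Matrix.of_apply, autocovariance]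
    ring
  · intro k _
    have := IntervalIntegrable.sum Finset.univ fun (l : Fin L) _ =>
      hint (star (v k) * v l) (((k : ℕ) : ℤ) - ((l : ℕ) : ℤ))
    simpa only [Finset.sum_fn] using this

theorem conjTranspose_covarianceMatrix (S : ℝ → ℝ) (L : ℕ) :
    (covarianceMatrix S L)ᴴ = covarianceMatrix S L := by
  ext k l
  simp only [Matrix.conjTranspose_apply, covarianceMatrix, Matrix.of_apply, autocovariance,
    ← starRingEnd_apply]
  rw [← intervalIntegral.intervalIntegral_conj]
  refine intervalIntegral.integral_congr fun x _ => ?_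
  simp only [map_mul, Complex.conj_ofReal, ← Complex.exp_conj]
  congr 2
  simp [Complex.conj_ofNat]
  ring

/-- White noise: the constant spectral density `1` has covariance matrix the identity. -/
theorem covarianceMatrix_one (L : ℕ) : covarianceMatrix (fun _ => 1) L = 1 := by
  ext k l
  rw [covarianceMatrix, Matrix.of_apply, autocovariance, Matrix.one_apply]
  simp only [Complex.ofReal_one, one_mul]
  split_ifs with h
  · simp [h]
  · have hn : (((k : ℕ) : ℤ) - ((l : ℕ) : ℤ) : ℤ) ≠ 0 := by
      rw [sub_ne_zero]
      exact_mod_cast fun h' => h (Fin.ext h')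
    generalize (((k : ℕ) : ℤ) - ((l : ℕ) : ℤ) : ℤ) = n at hn
    have hc : (2 * Real.pi * Complex.I * n : ℂ) ≠ 0 := by
      simp [Real.pi_ne_zero, hn]
    have := integral_exp_mul_complex (a := 0) (b := 1) hc
    have hcomm : ∀ x : ℝ, (2 * Real.pi * Complex.I * x * n : ℂ) = 2 * Real.pi * Complex.I * n * x :=
      fun x => by ring
    simp_rw [hcomm]
    rw [this, Complex.ofReal_one, mul_one, mul_comm (2 * Real.pi * Complex.I : ℂ),
      Complex.exp_int_mul_two_pi_mul_I]
    simp

/-- A lower bound of the spectral density is a lower bound of the Hermitian form of the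
covariance matrix. -/
theorem mul_sum_sq_le_norm_covarianceMatrix {S : ℝ → ℝ} (hS : ContinuousOn S (Set.Icc 0 1))
    {s : ℝ} (hs : ∀ x ∈ Set.Icc (0 : ℝ) 1, s ≤ S x) {L : ℕ} (v : Fin L → ℂ) :
    s * ∑ k, ‖v k‖ ^ 2 ≤ ‖star v ⬝ᵥ (covarianceMatrix S L *ᵥ v)‖ := by
  set p : ℝ → ℝ := fun x => ‖∑ k : Fin L,
    v k * Complex.exp (-(2 * Real.pi * Complex.I * x * (k : ℕ)))‖ ^ 2 with hp
  have hpc : Continuous p := by fun_prop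
  have hparseval : ∫ x in (0 : ℝ)..1, p x = ∑ k, ‖v k‖ ^ 2 := by
    have h := star_dotProduct_covarianceMatrix_mulVec (S := fun _ => 1) continuousOn_const v
    rw [covarianceMatrix_one, Matrix.one_mulVec] at h
    simp only [one_mul] at h
    rw [← Complex.ofReal_inj, ← h]
    simp [dotProduct, Complex.conj_mul']
  rw [star_dotProduct_covarianceMatrix_mulVec hS, Complex.norm_real, ← hparseval,
    ← intervalIntegral.integral_const_mul]
  refine (intervalIntegral.integral_mono_on zero_le_one ?_ ?_ fun x hx => ?_).trans
    (Real.le_norm_self _)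
  · exact (hpc.const_mul s).intervalIntegrable _ _
  · refine ContinuousOn.intervalIntegrable ?_
    rw [Set.uIcc_of_le zero_le_one]
    exact hS.mul hpc.continuousOn
  · exact mul_le_mul_of_nonneg_right (hs x hx) (by positivity)

theorem isUnit_covarianceMatrix {S : ℝ → ℝ} (hS : ContinuousOn S (Set.Icc 0 1))
    {s : ℝ} (hs0 : 0 < s) (hs : ∀ x ∈ Set.Icc (0 : ℝ) 1, s ≤ S x) (L : ℕ) :
    IsUnit (covarianceMatrix S L) := by
  rw [Matrix.isUnit_iff_isUnit_det, isUnit_iff_ne_zero]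
  intro hdet
  obtain ⟨v, hv, hRv⟩ := Matrix.exists_mulVec_eq_zero_iff.mpr hdet
  have h := mul_sum_sq_le_norm_covarianceMatrix hS hs v
  rw [hRv, dotProduct_zero, norm_zero] at h
  refine hv (funext fun k => ?_)
  have hsum : ∑ k, ‖v k‖ ^ 2 ≤ 0 := nonpos_of_mul_nonpos_right h hs0
  have := (Finset.sum_eq_zero_iff_of_nonneg fun i _ => by positivity).mp
    (le_antisymm hsum (Finset.sum_nonneg fun i _ => by positivity)) k (Finset.mem_univ k)
  simpa using this

/-- The inverse covariance matrix is bounded by `s⁻¹`, in a form that only mentions vectors: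
if `R z = x`, then `∑ ‖x j‖ ‖z j‖ ≤ s⁻¹ ∑ ‖x j‖²`. -/
theorem mul_sum_norm_mul_norm_le {S : ℝ → ℝ} (hS : ContinuousOn S (Set.Icc 0 1))
    {s : ℝ} (hs0 : 0 < s) (hs : ∀ x ∈ Set.Icc (0 : ℝ) 1, s ≤ S x) {L : ℕ} {x z : Fin L → ℂ}
    (hz : covarianceMatrix S L *ᵥ z = x) :
    s * ∑ j, ‖x j‖ * ‖z j‖ ≤ ∑ j, ‖x j‖ ^ 2 := by
  have hcoer := mul_sum_sq_le_norm_covarianceMatrix hS hs z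
  rw [hz] at hcoer
  have hnorm : ‖star z ⬝ᵥ x‖ ≤ ∑ j, ‖x j‖ * ‖z j‖ := by
    refine (norm_sum_le _ _).trans (le_of_eq (Finset.sum_congr rfl fun j _ => ?_))
    simp [mul_comm]
  have hcs := Finset.sum_mul_sq_le_sq_mul_sq Finset.univ (fun j => ‖x j‖) (fun j => ‖z j‖)
  have hQ : 0 ≤ ∑ j, ‖x j‖ * ‖z j‖ := Finset.sum_nonneg fun j _ => by positivity
  have hX : 0 ≤ ∑ j, ‖x j‖ ^ 2 := Finset.sum_nonneg fun j _ => by positivity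
  rcases hQ.eq_or_lt with h0 | hpos
  · rw [← h0, mul_zero]
    exact hX
  · refine le_of_mul_le_mul_right ?_ hpos
    nlinarith [mul_le_mul_of_nonneg_left (hcoer.trans hnorm) hX,
      mul_le_mul_of_nonneg_left hcs hs0.le]

/-! ### Truncation of the convolution to a window -/

/-- At each lag `k` at most `min |k| L` indices `j < L` have `j - k` outside `[0, L)`,
and `min |k| L ≤ L ^ (1 - α) |k| ^ α`. -/
theorem card_filter_sub_notMem_le (L : ℕ) (k : ℤ) {α : ℝ} (hα0 : 0 ≤ α) (hα1 : α ≤ 1) :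
    (((Finset.range L).filter fun j : ℕ => ¬(0 ≤ (j : ℤ) - k ∧ (j : ℤ) - k < L)).card : ℝ) ≤
      (L : ℝ) ^ (1 - α) * |(k : ℝ)| ^ α := by
  set c := ((Finset.range L).filter fun j : ℕ => ¬(0 ≤ (j : ℤ) - k ∧ (j : ℤ) - k < L)).card
  have hL : c ≤ L := (Finset.card_filter_le _ _).trans (Finset.card_range L).le
  have hk : c ≤ k.natAbs := by
    have hsub : ((Finset.range L).filter fun j : ℕ => ¬(0 ≤ (j : ℤ) - k ∧ (j : ℤ) - k < L)) ⊆
        if 0 ≤ k then Finset.range k.natAbs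
        else Finset.Ico (L - k.natAbs) L := by
      intro j hj
      simp only [Finset.mem_filter, Finset.mem_range] at hj
      split_ifs with h
      · rw [Finset.mem_range]
        omega
      · rw [Finset.mem_Ico]
        omega
    refine (Finset.card_le_card hsub).trans ?_
    split_ifs
    · simp
    · rw [Nat.card_Ico]
      omega
  have hk' : (c : ℝ) ≤ |(k : ℝ)| := by
    rw [← Int.cast_abs, ← Nat.cast_natAbs]
    exact_mod_cast hk
  have hL' : (c : ℝ) ≤ L := by exact_mod_cast hL
  calc (c : ℝ) = (c : ℝ) ^ (1 - α) * (c : ℝ) ^ α := by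
        rw [← Real.rpow_add' c.cast_nonneg (by simp), sub_add_cancel, Real.rpow_one]
    _ ≤ (L : ℝ) ^ (1 - α) * |(k : ℝ)| ^ α := by
        gcongr

/-- The mass `∑ |r(k)|` over the lags `k` that lead from `j` to a point `j - k` outside `[0, L)`:
up to normalization, the error made by cutting the `j`-th row of the two-sided convolution
with `r` down to the window. -/
noncomputable def truncationMass (r : ℤ → ℂ) (L j : ℕ) : ℝ :=
  ∑' k : ℤ, if 0 ≤ (j : ℤ) - k ∧ (j : ℤ) - k < L then 0 else ‖r k‖

theorem summable_truncationMass {r : ℤ → ℂ} (hr : Summable fun k => ‖r k‖) (L j : ℕ) :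
    Summable fun k : ℤ => if 0 ≤ (j : ℤ) - k ∧ (j : ℤ) - k < L then 0 else ‖r k‖ := by
  refine hr.of_nonneg_of_le (fun k => ?_) fun k => ?_ <;> split_ifs <;> simp

theorem truncationMass_nonneg (r : ℤ → ℂ) (L j : ℕ) : 0 ≤ truncationMass r L j :=
  tsum_nonneg fun k => by split_ifs <;> simp

theorem truncationMass_le_tsum {r : ℤ → ℂ} (hr : Summable fun k => ‖r k‖) (L j : ℕ) :
    truncationMass r L j ≤ ∑' k, ‖r k‖ :=
  (summable_truncationMass hr L j).tsum_le_tsum (fun k => by split_ifs <;> simp) hr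

/-- Most rows of the window are hardly affected by the truncation: in total the rows lose
`∑ₖ min(|k|, L) |r(k)|`, which the weighted summability of `r` controls. -/
theorem sum_truncationMass_le {r : ℤ → ℂ} {γ : ℝ} (hγ : 0 ≤ γ)
    (hw : Summable fun k : ℤ => (1 + |(k : ℝ)|) ^ γ * ‖r k‖) (hr : Summable fun k => ‖r k‖)
    (L : ℕ) :
    ∑ j ∈ Finset.range L, truncationMass r L j ≤
      (L : ℝ) ^ (1 - min γ 1) * ∑' k : ℤ, (1 + |(k : ℝ)|) ^ γ * ‖r k‖ := by
  have hs := fun j (_ : j ∈ Finset.range L) => summable_truncationMass hr L j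
  simp only [truncationMass]
  rw [← Summable.tsum_finsetSum hs, ← tsum_mul_left]
  refine (summable_sum hs).tsum_le_tsum (fun k => ?_) (hw.mul_left _)
  have hcount : ∑ j ∈ Finset.range L,
      (if 0 ≤ (j : ℤ) - k ∧ (j : ℤ) - k < L then (0 : ℝ) else ‖r k‖) =
      ((Finset.range L).filter fun j : ℕ => ¬(0 ≤ (j : ℤ) - k ∧ (j : ℤ) - k < L)).card * ‖r k‖ := by
    rw [Finset.sum_ite, Finset.sum_const_zero, zero_add, Finset.sum_const, nsmul_eq_mul]
  rw [hcount, ← mul_assoc]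
  refine mul_le_mul_of_nonneg_right ?_ (norm_nonneg _)
  refine (card_filter_sub_notMem_le L k (le_min hγ zero_le_one) (min_le_right γ 1)).trans ?_
  have hk := abs_nonneg (k : ℝ)
  gcongr
  calc |(k : ℝ)| ^ min γ 1 ≤ (1 + |(k : ℝ)|) ^ min γ 1 := by
        gcongr
        linarith
    _ ≤ (1 + |(k : ℝ)|) ^ γ := by
        gcongr
        · linarith
        · exact min_le_left _ _

/-! ### The spectral error -/

theorem norm_steeringVector (L : ℕ) (ν : ℝ) (k : Fin L) :
    ‖steeringVector L ν k‖ = 1 / Real.sqrt L := by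
  have : (2 * Real.pi * Complex.I * ((k : ℕ) : ℂ) * ν : ℂ) =
      ((2 * Real.pi * (k : ℕ) * ν : ℝ) : ℂ) * Complex.I := by
    push_cast
    ring
  rw [steeringVector, this, norm_mul, Complex.norm_exp_ofReal_mul_I, mul_one, norm_div, norm_one,
    Complex.norm_real, Real.norm_of_nonneg (Real.sqrt_nonneg _)]

theorem star_steeringVector_dotProduct_self {L : ℕ} (hL : 1 ≤ L) (ν : ℝ) :
    star (steeringVector L ν) ⬝ᵥ steeringVector L ν = 1 := by
  have hL0 : (L : ℝ) ≠ 0 := by positivity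
  have hk : ∀ k : Fin L, star (steeringVector L ν) k * steeringVector L ν k = ((1 / L : ℝ) : ℂ) := by
    intro k
    rw [Pi.star_apply, ← starRingEnd_apply, Complex.conj_mul', norm_steeringVector,
      ← Complex.ofReal_pow, div_pow, one_pow, Real.sq_sqrt L.cast_nonneg]
  simp only [dotProduct, hk]
  rw [Finset.sum_const, Finset.card_univ, Fintype.card_fin, nsmul_eq_mul]
  push_cast
  exact mul_one_div_cancel (by exact_mod_cast hL0)

/-- The steering vector is an approximate eigenvector of the covariance matrix for the eigenvalue
`S(ν)`. It is an exact one for the two-sided convolution with the autocovariances, and the defect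
in row `j` comes from the lags that leave the window. -/
theorem norm_smul_steeringVector_sub_le {S : ℝ → ℝ} (hS : ContinuousOn S (Set.Icc 0 1))
    (hr : Summable fun k => ‖autocovariance S k‖) {ν : ℝ} (hν : ν ∈ Set.Icc (0 : ℝ) 1)
    (L : ℕ) (j : Fin L) :
    ‖((S ν : ℂ) • steeringVector L ν - covarianceMatrix S L *ᵥ steeringVector L ν) j‖ ≤
      1 / Real.sqrt L * truncationMass (autocovariance S) L j := by
  set a : Fin L → ℂ := steeringVector L ν with ha
  set e : ℤ → ℂ := fun k => Complex.exp (2 * Real.pi * Complex.I * ν * ((-k : ℤ) : ℂ)) with he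
  have he1 : ∀ k, ‖e k‖ = 1 := by
    intro k
    have : (2 * Real.pi * Complex.I * ν * ((-k : ℤ) : ℂ) : ℂ) =
        ((2 * Real.pi * ν * (-k : ℤ) : ℝ) : ℂ) * Complex.I := by
      push_cast
      ring
    rw [he]
    simp only
    rw [this, Complex.norm_exp_ofReal_mul_I]
  -- the lags that stay in the window are those of the form `j - l` with `l < L`
  set F : Finset ℤ := Finset.univ.image fun l : Fin L => ((j : ℕ) : ℤ) - ((l : ℕ) : ℤ) with hF
  have hinj : Function.Injective fun l : Fin L => ((j : ℕ) : ℤ) - ((l : ℕ) : ℤ) := by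
    intro l l' h
    simp only [sub_right_inj, Nat.cast_inj] at h
    exact Fin.ext h
  have hmem : ∀ k : ℤ, k ∈ F ↔ 0 ≤ ((j : ℕ) : ℤ) - k ∧ ((j : ℕ) : ℤ) - k < L := by
    intro k
    rw [hF, Finset.mem_image]
    constructor
    · rintro ⟨l, -, rfl⟩
      omega
    · rintro ⟨h0, h1⟩
      refine ⟨⟨(((j : ℕ) : ℤ) - k).toNat, by omega⟩, Finset.mem_univ _, ?_⟩
      simp only
      omega
  have hrow : (covarianceMatrix S L *ᵥ a) j = (∑ k ∈ F, autocovariance S k * e k) * a j := by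
    rw [hF, Finset.sum_image fun l _ l' _ h => hinj h, Finset.sum_mul, Matrix.mulVec, dotProduct]
    refine Finset.sum_congr rfl fun l _ => ?_
    simp only [ha, he, steeringVector, covarianceMatrix, Matrix.of_apply]
    have hshift : Complex.exp (2 * Real.pi * Complex.I * ((l : ℕ) : ℂ) * ν) =
        Complex.exp (2 * Real.pi * Complex.I * ν *
          ((-(((j : ℕ) : ℤ) - ((l : ℕ) : ℤ)) : ℤ) : ℂ)) *
          Complex.exp (2 * Real.pi * Complex.I * ((j : ℕ) : ℂ) * ν) := by
      rw [← Complex.exp_add]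
      congr 1
      push_cast
      ring
    rw [hshift]
    ring
  have hsum := hasSum_autocovariance hS hr hν
  have hpart : HasSum (fun k => if k ∈ F then autocovariance S k * e k else 0)
      (∑ k ∈ F, autocovariance S k * e k) := by
    rw [← Finset.sum_congr rfl fun k hk => if_pos (c := k ∈ F) (e := (0 : ℂ)) hk]
    exact hasSum_sum_of_ne_finset_zero fun k hk => if_neg hk
  have hdiff := hsum.sub hpart
  have hbound : ‖(S ν : ℂ) - ∑ k ∈ F, autocovariance S k * e k‖ ≤
      truncationMass (autocovariance S) L j := by
    rw [← hdiff.tsum_eq]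
    refine tsum_of_norm_bounded (summable_truncationMass hr L j).hasSum fun k => ?_
    by_cases hk : k ∈ F
    · rw [if_pos hk, if_pos ((hmem k).mp hk)]
      simp [he]
    · rw [if_neg hk, if_neg (mt (hmem k).mpr hk), sub_zero, norm_mul]
      exact (mul_le_mul_of_nonneg_left (he1 k).le (norm_nonneg _)).trans (mul_one _).le
  rw [Pi.sub_apply, Pi.smul_apply, hrow, smul_eq_mul, ← sub_mul, norm_mul, norm_steeringVector,
    mul_comm]
  exact mul_le_mul_of_nonneg_left hbound (by positivity)

/-- With `a` the steering vector, `x = S(ν) a - R a` and `R z = x`, the error satisfies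
`S(ν) ε = aᴴ x + xᴴ z`. The first term is at most the mean of the truncation masses, the second at
most `s⁻¹ ‖x‖²`, that is, at most `s⁻¹` times the mean of their squares. -/
theorem norm_spectralError_le {S : ℝ → ℝ} (hS : ContinuousOn S (Set.Icc 0 1))
    {s : ℝ} (hs0 : 0 < s) (hs : ∀ x ∈ Set.Icc (0 : ℝ) 1, s ≤ S x)
    (hr : Summable fun k => ‖autocovariance S k‖) {M : ℝ}
    (hM : ∑' k, ‖autocovariance S k‖ ≤ M) {ν : ℝ} (hν : ν ∈ Set.Icc (0 : ℝ) 1)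
    {L : ℕ} (hL : 1 ≤ L) :
    ‖spectralError S L ν‖ ≤ s⁻¹ * (1 + s⁻¹ * M) *
      ((∑ j ∈ Finset.range L, truncationMass (autocovariance S) L j) / L) := by
  set a := steeringVector L ν with ha
  set R := covarianceMatrix S L with hR
  set t := truncationMass (autocovariance S) L with ht
  set x := (S ν : ℂ) • a - R *ᵥ a with hx
  set z := R⁻¹ *ᵥ x with hz
  set T := ∑ j ∈ Finset.range L, t j with hT
  have hunit : IsUnit R.det := (Matrix.isUnit_iff_isUnit_det _).mp
    (isUnit_covarianceMatrix hS hs0 hs L)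
  have hsν : s ≤ S ν := hs ν hν
  have hSν : 0 < S ν := hs0.trans_le hsν
  have hRz : R *ᵥ z = x := by
    rw [hz, Matrix.mulVec_mulVec, Matrix.mul_nonsing_inv _ hunit, Matrix.one_mulVec]
  have hza : z = (S ν : ℂ) • (R⁻¹ *ᵥ a) - a := by
    rw [hz, hx, Matrix.mulVec_sub, Matrix.mulVec_smul, Matrix.mulVec_mulVec,
      Matrix.nonsing_inv_mul _ hunit, Matrix.one_mulVec]
  have hε : spectralError S L ν = star a ⬝ᵥ z := by
    rw [hza, dotProduct_sub, dotProduct_smul, star_steeringVector_dotProduct_self hL,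
      smul_eq_mul, spectralError]
  have hherm : Rᴴ = R := conjTranspose_covarianceMatrix S L
  have hkey : (S ν : ℂ) * spectralError S L ν = star a ⬝ᵥ x + star x ⬝ᵥ z := by
    have h1 : star (R *ᵥ a) ⬝ᵥ z = star a ⬝ᵥ x := by
      rw [Matrix.star_mulVec, hherm, ← Matrix.dotProduct_mulVec, hRz]
    have h2 : star x = (S ν : ℂ) • star a - star (R *ᵥ a) := by
      rw [hx, star_sub, star_smul, ← starRingEnd_apply, Complex.conj_ofReal]
    rw [h2, sub_dotProduct, h1, smul_dotProduct, hε, smul_eq_mul]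
    ring
  have hxj : ∀ j : Fin L, ‖x j‖ ≤ 1 / Real.sqrt L * t j :=
    fun j => norm_smul_steeringVector_sub_le hS hr hν L j
  have hsq : 1 / Real.sqrt L * (1 / Real.sqrt L) = (1 / L : ℝ) := by
    rw [div_mul_div_comm, Real.mul_self_sqrt L.cast_nonneg, one_mul]
  have hTsum : ∑ j : Fin L, 1 / (L : ℝ) * t j = T / L := by
    rw [← Finset.mul_sum, Fin.sum_univ_eq_sum_range t, hT]
    ring
  have hax : ‖star a ⬝ᵥ x‖ ≤ T / L := by
    rw [← hTsum]
    refine (norm_sum_le _ _).trans (Finset.sum_le_sum fun j _ => ?_)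
    rw [norm_mul, Pi.star_apply, norm_star, norm_steeringVector, ← hsq, mul_assoc]
    exact mul_le_mul_of_nonneg_left (hxj j) (by positivity)
  have hxx : ∑ j, ‖x j‖ ^ 2 ≤ M * (T / L) := by
    rw [← hTsum, Finset.mul_sum]
    refine Finset.sum_le_sum fun j _ => ?_
    have htj : 0 ≤ t j := truncationMass_nonneg _ _ _
    calc ‖x j‖ ^ 2 ≤ (1 / Real.sqrt L * t j) ^ 2 := by
          gcongr
          exact hxj j
      _ = t j * (1 / L * t j) := by
          rw [← hsq]
          ring
      _ ≤ M * (1 / L * t j) := by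
          gcongr
          exact (truncationMass_le_tsum hr L j).trans hM
  have hxz : ‖star x ⬝ᵥ z‖ ≤ s⁻¹ * (M * (T / L)) := by
    rw [le_inv_mul_iff₀ hs0]
    refine le_trans ?_ ((mul_sum_norm_mul_norm_le hS hs0 hs hRz).trans hxx)
    gcongr
    refine (norm_sum_le _ _).trans (le_of_eq (Finset.sum_congr rfl fun j _ => ?_))
    rw [norm_mul, Pi.star_apply, norm_star]
  rw [mul_assoc, le_inv_mul_iff₀ hs0]
  calc s * ‖spectralError S L ν‖ ≤ ‖(S ν : ℂ) * spectralError S L ν‖ := by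
        rw [norm_mul, Complex.norm_real, Real.norm_of_nonneg hSν.le]
        gcongr
    _ ≤ T / L + s⁻¹ * (M * (T / L)) := by
        rw [hkey]
        exact (norm_add_le _ _).trans (add_le_add hax hxz)
    _ = (1 + s⁻¹ * M) * (T / L) := by ring

/-! ### Uniform bounds from the weighted summability -/

/-- A bound on the Beurling norm makes the weighted series converge as a real series. -/
theorem summable_and_tsum_le_of_beurlingNorm_le {γ : ℝ} {a : ℤ → ℂ} {B : ENNReal} (hB : B ≠ ⊤)
    (ha : beurlingNorm γ a ≤ B) :
    (Summable fun k : ℤ => (1 + |(k : ℝ)|) ^ γ * ‖a k‖) ∧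
      ∑' k : ℤ, (1 + |(k : ℝ)|) ^ γ * ‖a k‖ ≤ B.toReal := by
  have hnn : ∀ k : ℤ, 0 ≤ (1 + |(k : ℝ)|) ^ γ * ‖a k‖ := fun k => by positivity
  have hfin : beurlingNorm γ a ≠ ⊤ := ne_top_of_le_ne_top hB ha
  have hs : Summable fun k : ℤ => (1 + |(k : ℝ)|) ^ γ * ‖a k‖ := by
    simpa only [ENNReal.toReal_ofReal (hnn _)] using ENNReal.summable_toReal hfin
  refine ⟨hs, ?_⟩
  rw [beurlingNorm, ← ENNReal.ofReal_tsum_of_nonneg hnn hs] at ha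
  exact (ENNReal.ofReal_le_iff_le_toReal hB).mp ha

/-- The error is `O(L ^ (-min γ₀ 1))` uniformly in the family: the weight exponent `γ₀` itself is
attained, and no logarithm occurs for `γ₀ = 1`. -/
theorem exists_norm_spectralError_le_div_rpow {ι : Type*} {S : ι → ℝ → ℝ} {γ₀ : ℝ}
    (hγ₀ : 0 ≤ γ₀) (hS : ∀ m, ContinuousOn (S m) (Set.Icc 0 1)) {s : ℝ} (hs0 : 0 < s)
    (hs : ∀ m, ∀ ν ∈ Set.Icc (0 : ℝ) 1, s ≤ S m ν)
    (hr : (⨆ m, beurlingNorm γ₀ (autocovariance (S m))) < ⊤) :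
    ∃ κ : ℝ, 0 < κ ∧ ∀ L : ℕ, 1 ≤ L → ∀ m, ∀ ν ∈ Set.Icc (0 : ℝ) 1,
      ‖spectralError (S m) L ν‖ ≤ κ / (L : ℝ) ^ min γ₀ 1 := by
  set M := (⨆ m, beurlingNorm γ₀ (autocovariance (S m))).toReal with hM
  have hM0 : 0 ≤ M := ENNReal.toReal_nonneg
  refine ⟨s⁻¹ * (1 + s⁻¹ * M) * (M + 1), by positivity, fun L hL m ν hν => ?_⟩
  obtain ⟨hw, hwM⟩ := summable_and_tsum_le_of_beurlingNorm_le hr.ne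
    (le_iSup (fun m => beurlingNorm γ₀ (autocovariance (S m))) m)
  have hle : ∀ k : ℤ, ‖autocovariance (S m) k‖ ≤
      (1 + |(k : ℝ)|) ^ γ₀ * ‖autocovariance (S m) k‖ := fun k =>
    le_mul_of_one_le_left (norm_nonneg _)
      (Real.one_le_rpow (le_add_of_nonneg_right (abs_nonneg _)) hγ₀)
  have hsum : Summable fun k => ‖autocovariance (S m) k‖ :=
    hw.of_nonneg_of_le (fun k => norm_nonneg _) hle
  have hL0 : (0 : ℝ) < L := by positivity
  refine (norm_spectralError_le (hS m) hs0 (hs m) hsum ((hsum.tsum_le_tsum hle hw).trans hwM)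
    hν hL).trans ?_
  rw [mul_div_assoc]
  refine mul_le_mul_of_nonneg_left ?_ (by positivity)
  rw [div_le_div_iff₀ hL0 (by positivity)]
  calc (∑ j ∈ Finset.range L, truncationMass (autocovariance (S m)) L j) * (L : ℝ) ^ min γ₀ 1
      ≤ ((L : ℝ) ^ (1 - min γ₀ 1) * M) * (L : ℝ) ^ min γ₀ 1 := by
        gcongr
        refine (sum_truncationMass_le hγ₀ hw hsum L).trans ?_
        gcongr
    _ = M * L := by
        rw [mul_right_comm, ← Real.rpow_add hL0, sub_add_cancel, Real.rpow_one, mul_comm]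
    _ ≤ (M + 1) * L := by
        gcongr
        linarith

theorem mainTheorem4
    (S : ℕ+ → ℝ → ℝ) (γ₀ : ℝ) (hγ₀ : 0 < γ₀)
    (hS_cont : ∀ m, ContinuousOn (S m) (Set.Icc 0 1))
    (hS_upper : ∃ smax : ℝ, ∀ m, ∀ ν ∈ Set.Icc (0 : ℝ) 1, S m ν ≤ smax)
    (hS_lower : ∃ smin : ℝ, 0 < smin ∧ ∀ m, ∀ ν ∈ Set.Icc (0 : ℝ) 1, smin ≤ S m ν)
    (hr : (⨆ m, beurlingNorm γ₀ (autocovariance (S m))) < (⊤ : ENNReal)) :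
    (∀ m, ∀ L : ℕ, IsUnit (covarianceMatrix (S m) L)) ∧
    ∀ γ : ℝ, γ < γ₀ →
      (γ ≠ 1 → ∃ κ : ℝ, 0 < κ ∧ ∀ L : ℕ, 1 ≤ L → ∀ m, ∀ ν ∈ Set.Icc (0 : ℝ) 1,
        ‖spectralError (S m) L ν‖ ≤ κ / (L : ℝ) ^ (min γ 1)) ∧
      (γ = 1 → ∃ κ : ℝ, 0 < κ ∧ ∀ L : ℕ, 2 ≤ L → ∀ m, ∀ ν ∈ Set.Icc (0 : ℝ) 1,
        ‖spectralError (S m) L ν‖ ≤ κ * (Real.log L / L)) := by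
  obtain ⟨s, hs0, hs⟩ := hS_lower
  obtain ⟨κ, hκ, hbound⟩ := exists_norm_spectralError_le_div_rpow hγ₀.le hS_cont hs0 hs hr
  refine ⟨fun m L => isUnit_covarianceMatrix (hS_cont m) hs0 (hs m) L, fun γ hγ => ⟨fun _ => ?_,
    fun hγ1 => ?_⟩⟩
  · refine ⟨κ, hκ, fun L hL m ν hν => (hbound L hL m ν hν).trans ?_⟩
    have hL1 : (1 : ℝ) ≤ L := by exact_mod_cast hL
    gcongr
  · have hlog2 : 0 < Real.log 2 := Real.log_pos one_lt_two
    refine ⟨κ / Real.log 2, by positivity, fun L hL m ν hν =>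
      (hbound L (one_le_two.trans hL) m ν hν).trans ?_⟩
    have hL2 : (2 : ℝ) ≤ L := by exact_mod_cast hL
    rw [min_eq_right (hγ1 ▸ hγ.le), Real.rpow_one, div_mul_div_comm]
    rw [mul_comm (Real.log 2), ← div_mul_div_comm, mul_comm, ← mul_comm (κ / L)]
    refine le_mul_of_one_le_right (by positivity) ?_
    rw [one_le_div hlog2]
    exact Real.log_le_log two_pos hL2
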